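/- Let $M,N\ge 0$ be integers, let $q,\beta\in\mathbb C$ with $\beta\neq0$, and let $u_1,\dots,u_N\in\mathbb C\setminus\{0\}$ with $u_j^2\neq u_k^2$ for $j\neq k$. Let $W=V=\mathbb C^2$ have basis $|0\rangle,|1\rangle$, and let $L(u)$ be the operator on $W\otimes V$ given in the ordered basis $|0\rangle|0\rangle,|0\rangle|1\rangle,|1\rangle|0\rangle,|1\rangle|1\rangle$ by $$L(u)=\begin{pmatrix}u+q\beta u^{-1}&0&0&0\\0&q(u+\beta u^{-1})&1-q&0\\0&1-q&-\beta^{-1}u-u^{-1}&0\\0&0&0&-\beta^{-1}u-qu^{-1}\end{pmatrix}.$$ Let $L_{aj}(u)$ be $L(u)$ acting on $W_a\otimes V_j$ inside $W_a\otimes V_1\otimes\cdots\otimes V_M$, let $T_a(u)=L_{aM}(u)\cdots L_{a2}(u)L_{a1}(u)$, and let $B(u)={}_a\langle0|T_a(u)|1\rangle_a$, an operator on $V_1\otimes\cdots\otimes V_M$. Put $|\Omega\rangle=|0\rangle_1\otimes\cdots\otimes|0\rangle_M$, let $\langle\Omega|$ be its dual, and put $|\psi(\{u\}_N)\rangle=B(u_1)\cdots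 B(u_N)|\Omega\rangle$. For $1\le x_1<\cdots<x_N\le M$ put $\langle x_1\cdots x_N|=\langle\Omega|\sigma^+_{x_1}\cdots\sigma^+_{x_N}$, where $\sigma^+=|0\rangle\langle1|$. (i) If $u_j+q\beta u_j^{-1}\neq0$ and $-\beta^{-1}u_j-u_j^{-1}\neq0$ for all $j$, and $q\neq u_k^2u_j^{-2}$ for all $j<k$ (so that no denominator below vanishes), then $$\langle x_1\cdots x_N|\psi(\{u\}_N)\rangle=\prod_{j=1}^N\frac{(1-q)(u_j+q\beta u_j^{-1})^M}{-\beta^{-1}u_j-u_j^{-1}}\prod_{1\le j<k\le N}\frac{q-u_j^{-2}u_k^2}{1-u_j^{-2}u_k^2}\sum_{\sigma\in S_N}\ \prod_{\substack{1\le j<k\le N\\\sigma(j)>\sigma(k)}}\frac{1-q\,u_{\sigma(j)}^2u_{\sigma(k)}^{-2}}{q-u_{\sigma(j)}^2u_{\sigma(k)}^{-2}}\ \prod_{j=1}^N\left(\frac{-\beta^{-1}u_{\sigma(j)}-u_{\sigma(j)}^{-1}}{u_{\sigma(j)}+q\beta u_{\sigma(j)}^{-1}}\right)^{x_j}.$$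 (ii) At $q=0$, with $z_j=-\beta^{-1}-u_j^{-2}$ and $\lambda_j=x_{N-j+1}-N+j-1$ for $1\le j\le N$, $$\langle x_1\cdots x_N|\psi(\{u\}_N)\rangle=(-\beta)^{-N(N-1)/2}\prod_{j=1}^Nu_j^{M-1}\;G_\lambda(z;\beta),$$ where $$G_\lambda(z;\beta)=\frac{\det\bigl(z_j^{\lambda_k+N-k}(1+\beta z_j)^{k-1}\bigr)_{j,k=1}^N}{\prod_{1\le j<k\le N}(z_j-z_k)}$$ is the $\beta$-Grothendieck polynomial. -/

import Mathlib

open scoped BigOperators Matrix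

/-- Configurations of `M` sites: `0` is the empty state, `1` the particle occupied state.
They index the standard basis of `V_1 ⊗ ⋯ ⊗ V_M`, where `V_j = ℂ²`. -/
abbrev Config (M : ℕ) : Type := Fin M → Fin 2

/-- Operators on the quantum space `V_1 ⊗ ⋯ ⊗ V_M`, in the standard basis. -/
abbrev QuantumOp (M : ℕ) : Type := Matrix (Config M) (Config M) ℂ

/-- Operators on `W_a ⊗ V_1 ⊗ ⋯ ⊗ V_M`, where `W_a = ℂ²` is the auxiliary space. -/
abbrev TotalOp (M : ℕ) : Type := Matrix (Fin 2 × Config M) (Fin 2 × Config M) ℂ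

/-- The `β`-deformed `U_q(sl_2)` `L`-operator on `W ⊗ V`. The `4 × 4` matrix is written in the
ordered basis `|0⟩|0⟩, |0⟩|1⟩, |1⟩|0⟩, |1⟩|1⟩`, the first factor being the auxiliary one. -/
noncomputable def LOperator (q β u : ℂ) : Matrix (Fin 2 × Fin 2) (Fin 2 × Fin 2) ℂ :=
  (!![u + q * β * u⁻¹, 0, 0, 0;
      0, q * (u + β * u⁻¹), 1 - q, 0;
      0, 1 - q, -β⁻¹ * u - u⁻¹, 0;
      0, 0, 0, -β⁻¹ * u - q * u⁻¹] : Matrix (Fin 4) (Fin 4) ℂ).submatrix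
    finProdFinEquiv finProdFinEquiv

/-- `L_{aj}(u)`: the `L`-operator acting on the auxiliary space and on the `j`-th site, and as the
identity on all other sites. -/
noncomputable def siteL {M : ℕ} (q β u : ℂ) (j : Fin M) : TotalOp M :=
  Matrix.of fun r c =>
    if ∀ k, k ≠ j → r.2 k = c.2 k then LOperator q β u (r.1, r.2 j) (c.1, c.2 j) else 0

/-- The monodromy matrix `T_a(u) = L_{aM}(u) ⋯ L_{a2}(u) L_{a1}(u)`. -/
noncomputable def monodromy (M : ℕ) (q β u : ℂ) : TotalOp M :=
  (List.ofFn fun j : Fin M => siteL q β u j.rev).prod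

/-- The operator `B(u)`: the upper right block `_a⟨0| T_a(u) |1⟩_a` of the monodromy matrix. -/
noncomputable def BOperator (M : ℕ) (q β u : ℂ) : QuantumOp M :=
  Matrix.of fun s t => monodromy M q β u (0, s) (1, t)

/-- The coordinates of the vacuum `|Ω⟩ = |0⟩_1 ⊗ ⋯ ⊗ |0⟩_M`, and of its dual `⟨Ω|`. -/
def vacuum (M : ℕ) : Config M → ℂ := Pi.single (fun _ => 0) 1

/-- `σ⁺_j`: the matrix `σ⁺ = |0⟩⟨1|` acting on the `j`-th site. -/
def sigmaPlus {M : ℕ} (j : Fin M) : QuantumOp M :=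
  Matrix.of fun s t =>
    if ∀ k, k ≠ j → s k = t k then (!![0, 1; 0, 0] : Matrix (Fin 2) (Fin 2) ℂ) (s j) (t j) else 0

/-- The row vector `⟨x_1 ⋯ x_N| = ⟨Ω| σ⁺_{x_1} ⋯ σ⁺_{x_N}`. -/
def braConfig {M N : ℕ} (x : Fin N → Fin M) : Config M → ℂ :=
  vacuum M ᵥ* (List.ofFn fun j => sigmaPlus (x j)).prod

/-- The off-shell state `|ψ({u}_N)⟩ = B(u_1) ⋯ B(u_N) |Ω⟩`. -/
noncomputable def offShellState (M : ℕ) {N : ℕ} (q β : ℂ) (u : Fin N → ℂ) : Config M → ℂ :=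
  (List.ofFn fun j => BOperator M q β (u j)).prod *ᵥ vacuum M

/-- The wavefunction `⟨x_1 ⋯ x_N | ψ({u}_N)⟩`. -/
noncomputable def wavefunction {M N : ℕ} (q β : ℂ) (u : Fin N → ℂ) (x : Fin N → Fin M) : ℂ :=
  braConfig x ⬝ᵥ offShellState M q β u

/-- The `β`-Grothendieck polynomial
`G_λ(z; β) = det (z_j ^ (λ_k + N - k) (1 + β z_j) ^ (k - 1)) / ∏_{j < k} (z_j - z_k)`
(here with the indices `j, k` shifted to start from `0`). -/
noncomputable def grothendieck {N : ℕ} (lam : Fin N → ℕ) (z : Fin N → ℂ) (β : ℂ) : ℂ :=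
  (Matrix.of fun j k : Fin N =>
      z j ^ (lam k + (N - 1 - (k : ℕ))) * (1 + β * z j) ^ (k : ℕ)).det /
    ∏ p : Fin N × Fin N with p.1 < p.2, (z p.1 - z p.2)

/-- The Young diagram of a particle configuration, `λ_j = x_{N-j+1} - N + j - 1` for
`j = 1, …, N` and positions `1 ≤ x_1 < ⋯ < x_N ≤ M`. Here indices and positions both start from
`0`; `youngDiagram_add` shows that the subtraction does not truncate. -/
def youngDiagram {M N : ℕ} (x : Fin N → Fin M) (j : Fin N) : ℕ :=
  ((x j.rev : ℕ) + 1) + (j : ℕ) - N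

theorem youngDiagram_add {M N : ℕ} (x : Fin N → Fin M) (hx : StrictMono x) (j : Fin N) :
    youngDiagram x j + N = ((x j.rev : ℕ) + 1) + (j : ℕ) := by
  have h : ∀ (n : ℕ) (hn : n < N), n ≤ (x ⟨n, hn⟩ : ℕ) := by
    intro n
    induction n with
    | zero => intro _; exact Nat.zero_le _
    | succ n ih =>
      intro hn
      have h1 := ih (by omega)
      have h2 : x ⟨n, by omega⟩ < x ⟨n + 1, hn⟩ := hx (by simp [Fin.lt_def])
      rw [Fin.lt_def] at h2
      omega
  have h3 := h (j.rev : ℕ) j.rev.isLt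
  have h4 : (j.rev : ℕ) = N - (j + 1) := Fin.val_rev j
  have h5 := j.isLt
  simp only [Fin.eta] at h3
  unfold youngDiagram
  omega

/-!
The wavefunction is computed by removing the sites one at a time, starting from the last one.

Splitting off the last site expresses the entries of the monodromy matrix of `M + 1` sites through
those of `M` sites (`monodromy_succ`). By induction on `M` this lifts the `RLL` relation, a finite
check with the six-vertex `R`-matrix, to the `RTT` relation, of which two consequences are used:
the operators `B(u)` commute, and `D(u) B(v)` is a combination of `B(v) D(u)` and `B(u) D(v)`.
As `|Ω⟩` is an eigenvector of `D(u)`, these give the action of `D(u)` on every off-shell state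
(`DOperator_mulVec_finsetState`).

The two components of `B(u_1) ⋯ B(u_N) |Ω⟩` at the last site follow. If that site is empty, every
`B(u_j)` contributes its weight `u_j + q β u_j⁻¹`, and the off-shell state of `M` sites remains
(`finsetState_snoc_zero`). If it is occupied, the component is a sum over the parameter `u_k` carried
by the last particle, with an off-shell state in the other parameters (`finsetState_snoc_one`).
When one more operator `B(u_l)` is applied, `u_k` either is on the last site already or gets there
by an exchange with `u_l`; the two contributions combine into a single product by an identity
between rational functions. Iterating, the wavefunction is a sum over
`σ ∈ S_N` of products over the particles and over the pairs of particles
(`wavefunction_eq_sum_betheTerm`), valid even where weights of the `L`-operator vanish.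

Dividing the factors of the pairs by those of the identity permutation leaves a product over the
inversions of `σ`, which is the first formula (`betheTerm_perm`). At `q = 0`, in the variables
`z_j = -β⁻¹ - u_j⁻²`, the factor of a pair becomes `(-β)⁻¹ (1 + β z) / (z' - z)`. The product of the denominators is antisymmetric, so
it yields the sign of `σ` over a Vandermonde product, and the sum over `σ` is the Leibniz formula
for the determinant in the Grothendieck polynomial (`betheTerm_zero_perm`).
-/

/-! ### Splitting off the last site -/

theorem LOperator_apply (q β u : ℂ) (a s b t : Fin 2) :
    LOperator q β u (a, s) (b, t) =
      (!![!![u + q * β * u⁻¹, 0; 0, q * (u + β * u⁻¹)], !![0, 0; 1 - q, 0];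
          !![0, 1 - q; 0, 0], !![-β⁻¹ * u - u⁻¹, 0; 0, -β⁻¹ * u - q * u⁻¹]] :
        Matrix (Fin 2) (Fin 2) (Matrix (Fin 2) (Fin 2) ℂ)) a b s t := by
  fin_cases a <;> fin_cases s <;> fin_cases b <;> fin_cases t <;> rfl

theorem sum_config_succ {M : ℕ} (f : Config (M + 1) → ℂ) :
    ∑ s, f s = ∑ i : Fin 2, ∑ s : Config M, f (Fin.snoc s i) := by
  rw [← (Fin.snocEquiv fun _ => Fin 2).sum_comp, Fintype.sum_prod_type]
  rfl

/-- An operator on the auxiliary space and the first `M` sites, acting as the identity on an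
additional last site. -/
def extendLast {M : ℕ} (X : TotalOp M) : TotalOp (M + 1) :=
  Matrix.of fun r c =>
    if r.2 (Fin.last M) = c.2 (Fin.last M) then X (r.1, Fin.init r.2) (c.1, Fin.init c.2) else 0

theorem extendLast_one {M : ℕ} : extendLast (1 : TotalOp M) = 1 := by
  ext ⟨a, s⟩ ⟨b, t⟩
  induction s using Fin.snocCases with | _ s i
  induction t using Fin.snocCases with | _ t j
  simp only [extendLast, Matrix.of_apply, Matrix.one_apply, Prod.mk.injEq, Fin.snoc_last,
    Fin.init_snoc, Fin.snoc_inj]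
  split_ifs <;> tauto

theorem extendLast_mul {M : ℕ} (X Y : TotalOp M) :
    extendLast (X * Y) = extendLast X * extendLast Y := by
  ext ⟨a, s⟩ ⟨b, t⟩
  simp only [extendLast, Matrix.of_apply, Matrix.mul_apply, Fintype.sum_prod_type,
    sum_config_succ, Fin.snoc_last, Fin.init_snoc]
  split_ifs with h
  · refine Finset.sum_congr rfl fun c _ => ?_
    rw [Finset.sum_eq_single (t (Fin.last M))]
    · simp [h]
    · intro i _ hi
      simp [hi]
    · simp
  · symm
    refine Finset.sum_eq_zero fun c _ => Finset.sum_eq_zero fun i _ => Finset.sum_eq_zero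
      fun r _ => ?_
    split_ifs with h1 h2
    · exact absurd (h1.trans h2) h
    all_goals simp

theorem extendLast_list_prod {M : ℕ} (l : List (TotalOp M)) :
    extendLast l.prod = (l.map extendLast).prod := by
  induction l with
  | nil => simp [extendLast_one]
  | cons X l ih => simp [extendLast_mul, ih]

theorem siteL_castSucc {M : ℕ} (q β u : ℂ) (j : Fin M) :
    siteL q β u j.castSucc = extendLast (siteL q β u j) := by
  ext ⟨a, s⟩ ⟨b, t⟩
  have h : Fin.last M ≠ j.castSucc := (Fin.castSucc_lt_last j).ne'
  by_cases h0 : s (Fin.last M) = t (Fin.last M)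
  · simp only [siteL, extendLast, Matrix.of_apply, Fin.forall_fin_succ', Fin.init, ne_eq,
      Fin.castSucc_inj, h, h0, not_false_eq_true, forall_const, and_true, if_true]
    congr
  · simp [siteL, extendLast, Fin.forall_fin_succ', h, h0]

theorem monodromy_succ_eq_mul (M : ℕ) (q β u : ℂ) :
    monodromy (M + 1) q β u = siteL q β u (Fin.last M) * extendLast (monodromy M q β u) := by
  simp only [monodromy, List.ofFn_succ, Fin.rev_zero, List.prod_cons, extendLast_list_prod,
    List.map_ofFn, Function.comp_def, Fin.rev_succ, siteL_castSucc]

/-- The monodromy matrix of `M + 1` sites in terms of that of `M` sites: the auxiliary space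
meets the last site after all the others. -/
theorem monodromy_succ (M : ℕ) (q β u : ℂ) (a b i j : Fin 2) (s t : Config M) :
    monodromy (M + 1) q β u (a, Fin.snoc s i) (b, Fin.snoc t j) =
      ∑ c, LOperator q β u (a, i) (c, j) * monodromy M q β u (c, s) (b, t) := by
  rw [monodromy_succ_eq_mul, Matrix.mul_apply, Fintype.sum_prod_type]
  refine Finset.sum_congr rfl fun c _ => ?_
  rw [sum_config_succ, Finset.sum_eq_single j, Finset.sum_eq_single s]
  · simp [siteL, extendLast, Fin.forall_fin_succ', (Fin.castSucc_lt_last _).ne]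
  · intro r _ hr
    have : ¬ ∀ k, s k = r k := fun h => hr (funext h).symm
    simp [siteL, Fin.forall_fin_succ', (Fin.castSucc_lt_last _).ne, this]
  · simp
  · intro k _ hk
    simp [extendLast, hk]
  · simp

/-- The operator entry `_a⟨a| T_a(u) |b⟩_a` of the monodromy matrix. -/
noncomputable def monodromyEntry (M : ℕ) (q β u : ℂ) (a b : Fin 2) : QuantumOp M :=
  Matrix.of fun s t => monodromy M q β u (a, s) (b, t)

theorem monodromyEntry_succ (M : ℕ) (q β u : ℂ) (a b i j : Fin 2) (s t : Config M) :
    monodromyEntry (M + 1) q β u a b (Fin.snoc s i) (Fin.snoc t j) =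
      ∑ c, LOperator q β u (a, i) (c, j) * monodromyEntry M q β u c b s t :=
  monodromy_succ M q β u a b i j s t

theorem monodromyEntry_succ_mulVec (M : ℕ) (q β u : ℂ) (a b i : Fin 2) (s : Config M)
    (v : Config (M + 1) → ℂ) :
    (monodromyEntry (M + 1) q β u a b *ᵥ v) (Fin.snoc s i) =
      ∑ j, ∑ c, LOperator q β u (a, i) (c, j) *
        (monodromyEntry M q β u c b *ᵥ fun t => v (Fin.snoc t j)) s := by
  simp only [Matrix.mulVec, dotProduct, sum_config_succ, monodromyEntry_succ, Finset.sum_mul,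
    Finset.mul_sum, mul_assoc]
  exact Finset.sum_congr rfl fun j _ => Finset.sum_comm

theorem monodromyEntry_succ_mul (M : ℕ) (q β u v : ℂ) (a b a' b' i j : Fin 2) (s t : Config M) :
    (monodromyEntry (M + 1) q β u a b * monodromyEntry (M + 1) q β v a' b')
        (Fin.snoc s i) (Fin.snoc t j) =
      ∑ c, ∑ c', (∑ r, LOperator q β u (a, i) (c, r) * LOperator q β v (a', r) (c', j)) *
        (monodromyEntry M q β u c b * monodromyEntry M q β v c' b') s t := by
  simp only [Matrix.mul_apply, sum_config_succ, monodromyEntry_succ,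
    Finset.mul_sum, Fin.sum_univ_two, Finset.sum_add_distrib, mul_add, add_mul]
  simp only [← Finset.sum_add_distrib]
  refine Finset.sum_congr rfl fun r _ => ?_
  ring

/-! ### Exchange relations -/

/-- The six-vertex `R`-matrix intertwining the `L`-operators with spectral parameters `u`
and `v`. -/
def sixVertexR (q u v : ℂ) (i i' k k' : Fin 2) : ℂ :=
  (!![!![u ^ 2 - q * v ^ 2, 0; 0, q * (u ^ 2 - v ^ 2)], !![0, 0; (1 - q) * u * v, 0];
      !![0, (1 - q) * u * v; 0, 0], !![u ^ 2 - v ^ 2, 0; 0, u ^ 2 - q * v ^ 2]] :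
    Matrix (Fin 2) (Fin 2) (Matrix (Fin 2) (Fin 2) ℂ)) i k i' k'

/-- The `RLL` relation, for each pair of matrix indices of the quantum space. -/
theorem RLL (q β u v : ℂ) (hβ : β ≠ 0) (hu : u ≠ 0) (hv : v ≠ 0) (i i' j j' a b : Fin 2) :
    ∑ k, ∑ k', sixVertexR q u v i i' k k' *
        ∑ r, LOperator q β u (k, a) (j, r) * LOperator q β v (k', r) (j', b) =
      ∑ k, ∑ k', (∑ r, LOperator q β v (i', a) (k', r) * LOperator q β u (i, r) (k, b)) *
        sixVertexR q u v k k' j j' := by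
  -- an identity of rational functions for each of the 64 choices of the indices
  simp only [LOperator_apply, sixVertexR, Fin.sum_univ_two]
  fin_cases i <;> fin_cases i' <;> fin_cases j <;> fin_cases j' <;> fin_cases a <;>
    fin_cases b <;> simp <;> (field_simp <;> ring)

theorem monodromyEntry_zero (q β u : ℂ) (a b : Fin 2) :
    monodromyEntry 0 q β u a b = if a = b then 1 else 0 := by
  ext s t
  simp only [monodromyEntry, monodromy, List.ofFn_zero, List.prod_nil, Matrix.of_apply,
    Matrix.one_apply, Subsingleton.elim s t, Prod.mk.injEq, and_true]
  split_ifs <;> simp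

/-- The `RTT` relation, entry by entry in the two auxiliary spaces. -/
theorem RTT (M : ℕ) (q β u v : ℂ) (hβ : β ≠ 0) (hu : u ≠ 0) (hv : v ≠ 0) (i i' j j' : Fin 2) :
    ∑ k, ∑ k', sixVertexR q u v i i' k k' •
        (monodromyEntry M q β u k j * monodromyEntry M q β v k' j') =
      ∑ k, ∑ k', sixVertexR q u v k k' j j' •
        (monodromyEntry M q β v i' k' * monodromyEntry M q β u i k) := by
  induction M generalizing i i' j j' with
  | zero => simp [monodromyEntry_zero]
  | succ M ih =>
    ext s t
    induction s using Fin.snocCases with | _ s a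
    induction t using Fin.snocCases with | _ t b
    have hR := fun c c' => RLL q β u v hβ hu hv i i' c c' a b
    have hT := fun l l' => congrFun (congrFun (ih l l' j j') s) t
    simp only [Matrix.sum_apply, Matrix.smul_apply, smul_eq_mul, monodromyEntry_succ_mul] at hT ⊢
    -- the two-site products of `L`-operators, and those of monodromy entries, enter as units
    generalize hA : (fun k j k' j' => ∑ r, LOperator q β u (k, a) (j, r) *
      LOperator q β v (k', r) (j', b)) = A at hR
    generalize hB : (fun i' k' i k => ∑ r, LOperator q β v (i', a) (k', r) *
      LOperator q β u (i, r) (k, b)) = B at hR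
    simp only [funext_iff] at hA hB
    simp only [hA, hB] at hR ⊢
    simp only [Fin.sum_univ_two] at hR hT ⊢
    linear_combination
      hR 0 0 * (monodromyEntry M q β u 0 j * monodromyEntry M q β v 0 j') s t +
      hR 0 1 * (monodromyEntry M q β u 0 j * monodromyEntry M q β v 1 j') s t +
      hR 1 0 * (monodromyEntry M q β u 1 j * monodromyEntry M q β v 0 j') s t +
      hR 1 1 * (monodromyEntry M q β u 1 j * monodromyEntry M q β v 1 j') s t +
      B i' 0 i 0 * hT 0 0 + B i' 1 i 0 * hT 0 1 + B i' 0 i 1 * hT 1 0 + B i' 1 i 1 * hT 1 1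

theorem BOperator_eq (M : ℕ) (q β u : ℂ) : BOperator M q β u = monodromyEntry M q β u 0 1 := rfl

/-- The diagonal entry `D(u) = _a⟨1| T_a(u) |1⟩_a` of the monodromy matrix. -/
noncomputable def DOperator (M : ℕ) (q β u : ℂ) : QuantumOp M := monodromyEntry M q β u 1 1

theorem smul_BOperator_mul_comm (M : ℕ) (q β u v : ℂ) (hβ : β ≠ 0) (hu : u ≠ 0) (hv : v ≠ 0) :
    (u ^ 2 - q * v ^ 2) • (BOperator M q β u * BOperator M q β v) =
      (u ^ 2 - q * v ^ 2) • (BOperator M q β v * BOperator M q β u) := by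
  simpa [sixVertexR, BOperator_eq] using RTT M q β u v hβ hu hv 0 0 1 1

/-- The two alternatives of `h` correspond to the `RTT` relation for `(u, v)` and for `(v, u)`: it is
enough that one of the two `R`-matrices has a nonzero corner entry. -/
theorem BOperator_commute (M : ℕ) (q β u v : ℂ) (hβ : β ≠ 0) (hu : u ≠ 0) (hv : v ≠ 0)
    (h : u ^ 2 - q * v ^ 2 ≠ 0 ∨ v ^ 2 - q * u ^ 2 ≠ 0) :
    Commute (BOperator M q β u) (BOperator M q β v) := by
  rcases h with h | h
  · exact smul_right_injective _ h (smul_BOperator_mul_comm M q β u v hβ hu hv)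
  · exact (smul_right_injective _ h (smul_BOperator_mul_comm M q β v u hβ hv hu)).symm

/-- The factor picked up by `D(u)` when it passes through `B(v)`. -/
noncomputable def passFactor (q u v : ℂ) : ℂ := (u ^ 2 - q * v ^ 2) / (u ^ 2 - v ^ 2)

/-- The factor picked up when `D(u)` and `B(v)` exchange their spectral parameters. -/
noncomputable def swapFactor (q u v : ℂ) : ℂ := (1 - q) * u * v / (v ^ 2 - u ^ 2)

theorem DOperator_mul_BOperator (M : ℕ) (q β u v : ℂ) (hβ : β ≠ 0) (hu : u ≠ 0) (hv : v ≠ 0)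
    (huv : u ^ 2 ≠ v ^ 2) :
    DOperator M q β u * BOperator M q β v =
      passFactor q u v • (BOperator M q β v * DOperator M q β u) +
      swapFactor q u v • (BOperator M q β u * DOperator M q β v) := by
  have h := RTT M q β u v hβ hu hv 1 0 1 1
  simp only [sixVertexR, Fin.sum_univ_two] at h
  simp only [Matrix.of_apply, Matrix.cons_val_zero, Matrix.cons_val_one, Matrix.cons_val',
    Matrix.cons_val_fin_one, zero_smul, zero_add, add_zero] at h
  have hne : u ^ 2 - v ^ 2 ≠ 0 := sub_ne_zero.2 huv
  have hne' : v ^ 2 - u ^ 2 ≠ 0 := sub_ne_zero.2 huv.symm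
  apply smul_right_injective _ hne
  simp only [BOperator_eq, DOperator, passFactor, swapFactor, smul_add, smul_smul]
  rw [mul_div_cancel₀ _ hne, ← h]
  rw [show (u ^ 2 - v ^ 2) * ((1 - q) * u * v / (v ^ 2 - u ^ 2)) = -((1 - q) * u * v) by
    field_simp; ring]
  module

/-! ### Action on the vacuum and on the last site -/

theorem vacuum_snoc_zero (M : ℕ) :
    (fun t : Config M => vacuum (M + 1) (Fin.snoc t 0)) = vacuum M := by
  ext t
  have h : (Fin.snoc t 0 : Config (M + 1)) = (fun _ => 0) ↔ t = fun _ => 0 := by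
    simp [funext_iff, Fin.forall_fin_succ']
  simp [vacuum, Pi.single_apply, h]

theorem vacuum_snoc_one (M : ℕ) : (fun t : Config M => vacuum (M + 1) (Fin.snoc t 1)) = 0 := by
  ext t
  have h : (Fin.snoc t 1 : Config (M + 1)) ≠ fun _ => 0 := fun h => by
    simpa using congrFun h (Fin.last M)
  simp [vacuum, h]

theorem DOperator_mulVec_vacuum (M : ℕ) (q β u : ℂ) :
    DOperator M q β u *ᵥ vacuum M = (-β⁻¹ * u - u⁻¹) ^ M • vacuum M := by
  induction M with
  | zero => simp [DOperator, monodromyEntry_zero]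
  | succ M ih =>
    ext s
    induction s using Fin.snocCases with | _ s i
    rw [DOperator, monodromyEntry_succ_mulVec]
    have h0 := congrFun (vacuum_snoc_zero M) s
    have h1 := congrFun (vacuum_snoc_one M) s
    have hD := congrFun ih s
    simp only [DOperator] at hD
    simp only [Fin.sum_univ_two, vacuum_snoc_zero, vacuum_snoc_one, Matrix.mulVec_zero, hD,
      LOperator_apply, Pi.smul_apply]
    fin_cases i
    · simp at h0 ⊢
      rw [h0]
      ring
    · simp at h1 ⊢
      exact Or.inr h1

theorem BOperator_succ_mulVec_zero (M : ℕ) (q β u : ℂ) (v : Config (M + 1) → ℂ) :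
    (fun s : Config M => (BOperator (M + 1) q β u *ᵥ v) (Fin.snoc s 0)) =
      (u + q * β * u⁻¹) • (BOperator M q β u *ᵥ fun t => v (Fin.snoc t 0)) := by
  ext s
  rw [BOperator_eq, monodromyEntry_succ_mulVec]
  simp [Fin.sum_univ_two, LOperator_apply, BOperator_eq]

theorem BOperator_succ_mulVec_one (M : ℕ) (q β u : ℂ) (v : Config (M + 1) → ℂ) :
    (fun s : Config M => (BOperator (M + 1) q β u *ᵥ v) (Fin.snoc s 1)) =
      (q * (u + β * u⁻¹)) • (BOperator M q β u *ᵥ fun t => v (Fin.snoc t 1)) +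
      (1 - q) • (DOperator M q β u *ᵥ fun t => v (Fin.snoc t 0)) := by
  ext s
  rw [BOperator_eq, monodromyEntry_succ_mulVec]
  simp [Fin.sum_univ_two, LOperator_apply, BOperator_eq, DOperator, add_comm]

/-! ### Off-shell states and their components at the last site -/

theorem pairwise_commute_BOperator {ι : Type*} {q β : ℂ} {u : ι → ℂ}
    (hc : ∀ M i j, Commute (BOperator M q β (u i)) (BOperator M q β (u j))) (M : ℕ)
    (S : Finset ι) :
    (S : Set ι).Pairwise (Function.onFun Commute fun i => BOperator M q β (u i)) :=
  fun i _ j _ _ => hc M i j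

/-- The vector `∏_{i ∈ S} B(u_i) |Ω⟩`; the operators commute, so that no order is needed. -/
noncomputable def finsetState {ι : Type*} (M : ℕ) {q β : ℂ} {u : ι → ℂ}
    (hc : ∀ M i j, Commute (BOperator M q β (u i)) (BOperator M q β (u j))) (S : Finset ι) :
    Config M → ℂ :=
  S.noncommProd (fun i => BOperator M q β (u i)) (pairwise_commute_BOperator hc M S) *ᵥ vacuum M

theorem finsetState_empty {ι : Type*} {q β : ℂ} {u : ι → ℂ}
    (hc : ∀ M i j, Commute (BOperator M q β (u i)) (BOperator M q β (u j))) (M : ℕ) :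
    finsetState M hc ∅ = vacuum M := by
  rw [finsetState, Finset.noncommProd_empty, Matrix.one_mulVec]

section States

variable {ι : Type*} [DecidableEq ι] {q β : ℂ} {u : ι → ℂ}
  (hc : ∀ M i j, Commute (BOperator M q β (u i)) (BOperator M q β (u j)))

theorem finsetState_insert (M : ℕ) {i : ι} {S : Finset ι} (hi : i ∉ S) :
    finsetState M hc (insert i S) = BOperator M q β (u i) *ᵥ finsetState M hc S := by
  rw [finsetState, Finset.noncommProd_insert_of_notMem _ _ _ _ hi, ← Matrix.mulVec_mulVec,
    finsetState]

/-- The action of `D(u_i)` on an off-shell state: the eigenvalue term, and the terms in which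
`u_i` has replaced one of the spectral parameters of the state. -/
theorem DOperator_mulVec_finsetState (M : ℕ) (hβ : β ≠ 0) (hu : ∀ i, u i ≠ 0)
    (hdist : ∀ i j, i ≠ j → u i ^ 2 ≠ u j ^ 2) {i : ι} {S : Finset ι} (hi : i ∉ S) :
    DOperator M q β (u i) *ᵥ finsetState M hc S =
      ((-β⁻¹ * u i - (u i)⁻¹) ^ M * ∏ j ∈ S, passFactor q (u i) (u j)) • finsetState M hc S +
      ∑ k ∈ S, (swapFactor q (u i) (u k) * (-β⁻¹ * u k - (u k)⁻¹) ^ M *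
        ∏ j ∈ S.erase k, passFactor q (u k) (u j)) •
          (BOperator M q β (u i) *ᵥ finsetState M hc (S.erase k)) := by
  induction S using Finset.induction generalizing i with
  | empty => simp [finsetState_empty, DOperator_mulVec_vacuum]
  | insert l S hl ih =>
    have hil : i ≠ l := fun h => hi (h ▸ Finset.mem_insert_self _ _)
    have hiS : i ∉ S := fun h => hi (Finset.mem_insert_of_mem h)
    rw [finsetState_insert hc M hl, Matrix.mulVec_mulVec,
      DOperator_mul_BOperator M q β _ _ hβ (hu i) (hu l) (hdist i l hil), Matrix.add_mulVec,
      Matrix.smul_mulVec, Matrix.smul_mulVec, ← Matrix.mulVec_mulVec, ← Matrix.mulVec_mulVec,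
      ih hiS, ih hl, Finset.sum_insert hl, Finset.erase_insert hl, Finset.prod_insert hl]
    -- for `k ∈ S`, the parameter `u_k` is exchanged directly with `u_i`, or by way of `u_l`
    have hS : ∀ k ∈ S, (swapFactor q (u i) (u k) * (-β⁻¹ * u k - (u k)⁻¹) ^ M *
          ∏ j ∈ (insert l S).erase k, passFactor q (u k) (u j)) •
            (BOperator M q β (u i) *ᵥ finsetState M hc ((insert l S).erase k)) =
        passFactor q (u i) (u l) • (BOperator M q β (u l) *ᵥ
          ((swapFactor q (u i) (u k) * (-β⁻¹ * u k - (u k)⁻¹) ^ M *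
            ∏ j ∈ S.erase k, passFactor q (u k) (u j)) •
              (BOperator M q β (u i) *ᵥ finsetState M hc (S.erase k)))) +
        swapFactor q (u i) (u l) • (BOperator M q β (u i) *ᵥ
          ((swapFactor q (u l) (u k) * (-β⁻¹ * u k - (u k)⁻¹) ^ M *
            ∏ j ∈ S.erase k, passFactor q (u k) (u j)) •
              (BOperator M q β (u l) *ᵥ finsetState M hc (S.erase k)))) := by
      intro k hk
      have hkl : k ≠ l := fun h => hl (h ▸ hk)
      have hik : i ≠ k := fun h => hiS (h ▸ hk)
      have hlk : l ∉ S.erase k := fun h => hl (Finset.mem_of_mem_erase h)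
      rw [Finset.erase_insert_of_ne hkl.symm, Finset.prod_insert hlk,
        finsetState_insert hc M hlk, Matrix.mulVec_smul, Matrix.mulVec_smul,
        Matrix.mulVec_mulVec, Matrix.mulVec_mulVec, (hc M l i).eq, smul_smul, smul_smul,
        ← add_smul]
      congr 1
      have h1 := sub_ne_zero.2 (hdist i k hik)
      have h2 := sub_ne_zero.2 (hdist i l hil)
      have h3 := sub_ne_zero.2 (hdist k l hkl)
      have h1' := sub_ne_zero.2 (hdist k i hik.symm)
      have h2' := sub_ne_zero.2 (hdist l i hil.symm)
      have h3' := sub_ne_zero.2 (hdist l k hkl.symm)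
      have key : swapFactor q (u i) (u k) * passFactor q (u k) (u l) =
          passFactor q (u i) (u l) * swapFactor q (u i) (u k) +
            swapFactor q (u i) (u l) * swapFactor q (u l) (u k) := by
        simp only [swapFactor, passFactor]
        field_simp
        ring
      linear_combination ((-β⁻¹ * u k - (u k)⁻¹) ^ M *
        ∏ j ∈ S.erase k, passFactor q (u k) (u j)) * key
    rw [Finset.sum_congr rfl hS, Finset.sum_add_distrib, Matrix.mulVec_add, Matrix.mulVec_add,
      Matrix.mulVec_sum, Matrix.mulVec_sum, Matrix.mulVec_smul, Matrix.mulVec_smul, smul_add,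
      smul_add, Finset.smul_sum, Finset.smul_sum]
    module

theorem finsetState_snoc_zero (M : ℕ) (S : Finset ι) :
    (fun s : Config M => finsetState (M + 1) hc S (Fin.snoc s 0)) =
      (∏ i ∈ S, (u i + q * β * (u i)⁻¹)) • finsetState M hc S := by
  induction S using Finset.induction with
  | empty => simp [finsetState_empty, vacuum_snoc_zero]
  | insert l S hl ih =>
    rw [finsetState_insert hc _ hl, BOperator_succ_mulVec_zero, ih, Finset.prod_insert hl,
      finsetState_insert hc _ hl, Matrix.mulVec_smul, smul_smul]

/-- If the last site is occupied, exactly one spectral parameter `u_k` is responsible for it, and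
the remaining ones form an off-shell state on the other sites. -/
theorem finsetState_snoc_one (M : ℕ) (hβ : β ≠ 0) (hu : ∀ i, u i ≠ 0)
    (hdist : ∀ i j, i ≠ j → u i ^ 2 ≠ u j ^ 2) (S : Finset ι) :
    (fun s : Config M => finsetState (M + 1) hc S (Fin.snoc s 1)) =
      ∑ k ∈ S, ((1 - q) * (-β⁻¹ * u k - (u k)⁻¹) ^ M *
        ∏ j ∈ S.erase k, (u j + q * β * (u j)⁻¹) * passFactor q (u k) (u j)) •
          finsetState M hc (S.erase k) := by
  induction S using Finset.induction with
  | empty => simp [finsetState_empty, vacuum_snoc_one]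
  | insert l S hl ih =>
    rw [finsetState_insert hc _ hl, BOperator_succ_mulVec_one, ih, finsetState_snoc_zero,
      Matrix.mulVec_smul, DOperator_mulVec_finsetState hc M hβ hu hdist hl,
      Finset.sum_insert hl, Finset.erase_insert hl]
    -- for `k ∈ S`, the particle carrying `u_k` was there already, or `u_k` comes from `D(u_l)`
    have hS : ∀ k ∈ S, ((1 - q) * (-β⁻¹ * u k - (u k)⁻¹) ^ M *
          ∏ j ∈ (insert l S).erase k, (u j + q * β * (u j)⁻¹) * passFactor q (u k) (u j)) •
            finsetState M hc ((insert l S).erase k) =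
        (q * (u l + β * (u l)⁻¹)) • (BOperator M q β (u l) *ᵥ
          (((1 - q) * (-β⁻¹ * u k - (u k)⁻¹) ^ M *
            ∏ j ∈ S.erase k, (u j + q * β * (u j)⁻¹) * passFactor q (u k) (u j)) •
              finsetState M hc (S.erase k))) +
        (1 - q) • (∏ i ∈ S, (u i + q * β * (u i)⁻¹)) •
          ((swapFactor q (u l) (u k) * (-β⁻¹ * u k - (u k)⁻¹) ^ M *
            ∏ j ∈ S.erase k, passFactor q (u k) (u j)) •
              (BOperator M q β (u l) *ᵥ finsetState M hc (S.erase k))) := by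
      intro k hk
      have hkl : k ≠ l := fun h => hl (h ▸ hk)
      have hlk : l ∉ S.erase k := fun h => hl (Finset.mem_of_mem_erase h)
      rw [Finset.erase_insert_of_ne hkl.symm, Finset.prod_insert hlk,
        finsetState_insert hc M hlk, Matrix.mulVec_smul, smul_smul, smul_smul, smul_smul,
        ← add_smul, ← Finset.mul_prod_erase S _ hk, Finset.prod_mul_distrib]
      congr 1
      have h3 := sub_ne_zero.2 (hdist k l hkl)
      have h3' := sub_ne_zero.2 (hdist l k hkl.symm)
      have hk0 := hu k
      have hl0 := hu l
      have key : (u l + q * β * (u l)⁻¹) * passFactor q (u k) (u l) =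
          q * (u l + β * (u l)⁻¹) + (u k + q * β * (u k)⁻¹) * swapFactor q (u l) (u k) := by
        simp only [swapFactor, passFactor]
        field_simp
        ring
      linear_combination ((1 - q) * (-β⁻¹ * u k - (u k)⁻¹) ^ M *
        (∏ j ∈ S.erase k, (u j + q * β * (u j)⁻¹)) *
        ∏ j ∈ S.erase k, passFactor q (u k) (u j)) * key
    rw [Finset.sum_congr rfl hS, Finset.sum_add_distrib, Matrix.mulVec_sum, Finset.smul_sum,
      smul_add, Finset.smul_sum, smul_add, Finset.smul_sum, Finset.prod_mul_distrib]
    module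

end States

/-! ### The wavefunction as a sum over permutations -/

theorem prod_pairs_lt_succ {n : ℕ} (g : Fin (n + 1) → Fin (n + 1) → ℂ) :
    ∏ p : Fin (n + 1) × Fin (n + 1) with p.1 < p.2, g p.1 p.2 =
      (∏ j : Fin n, g j.castSucc (Fin.last n)) *
        ∏ p : Fin n × Fin n with p.1 < p.2, g p.1.castSucc p.2.castSucc := by
  simp only [Finset.prod_filter, Fintype.prod_prod_type, Fin.prod_univ_castSucc,
    Fin.castSucc_lt_castSucc_iff, Fin.castSucc_lt_last, if_true, lt_self_iff_false, if_false,
    (Fin.castSucc_lt_last _).not_gt, Finset.prod_const_one, mul_one, Finset.prod_mul_distrib]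
  ring

/-- The permutation of `Fin (n + 1)` that sends the last element to `k` and acts on the others
as `τ`, up to the order-preserving bijections with `Fin n`. -/
def permOfLast {n : ℕ} (k : Fin (n + 1)) (τ : Equiv.Perm (Fin n)) : Equiv.Perm (Fin (n + 1)) :=
  ((finSuccEquiv' (Fin.last n)).trans (Equiv.optionCongr τ)).trans (finSuccEquiv' k).symm

@[simp] theorem permOfLast_last {n : ℕ} (k : Fin (n + 1)) (τ : Equiv.Perm (Fin n)) :
    permOfLast k τ (Fin.last n) = k := by
  simp [permOfLast]

@[simp] theorem permOfLast_castSucc {n : ℕ} (k : Fin (n + 1)) (τ : Equiv.Perm (Fin n))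
    (j : Fin n) : permOfLast k τ j.castSucc = k.succAbove (τ j) := by
  have h : finSuccEquiv' (Fin.last n) j.castSucc = some j := by
    rw [← Fin.succAbove_last_apply, finSuccEquiv'_succAbove]
  simp [permOfLast, h]

theorem permOfLast_bijective (n : ℕ) :
    Function.Bijective fun p : Fin (n + 1) × Equiv.Perm (Fin n) => permOfLast p.1 p.2 := by
  rw [Fintype.bijective_iff_injective_and_card]
  refine ⟨?_, by simp [Fintype.card_perm, Nat.factorial_succ]⟩
  rintro ⟨k, τ⟩ ⟨l, ρ⟩ h
  have hkl : k = l := by simpa using DFunLike.congr_fun h (Fin.last n)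
  subst hkl
  refine Prod.ext rfl (Equiv.ext fun j => ?_)
  simpa using DFunLike.congr_fun h j.castSucc

theorem sum_perm_succ {n : ℕ} (F : Equiv.Perm (Fin (n + 1)) → ℂ) :
    ∑ σ, F σ = ∑ k, ∑ τ, F (permOfLast k τ) := by
  rw [← (permOfLast_bijective n).sum_comp, Fintype.sum_prod_type]

/-- The configuration of `M` sites with particles at the positions `x j`, counted from `0`. -/
def occupation (M : ℕ) {N : ℕ} (x : Fin N → ℕ) : Config M :=
  fun k => if ∃ j, x j = k then 1 else 0

theorem occupation_succ_of_lt {M N : ℕ} {x : Fin N → ℕ} (h : ∀ j, x j < M) :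
    occupation (M + 1) x = Fin.snoc (occupation M x) 0 := by
  ext k
  induction k using Fin.lastCases with
  | last => simp [occupation, fun j => (h j).ne]
  | cast k => simp [occupation]

theorem occupation_succ_of_eq {M n : ℕ} {x : Fin (n + 1) → ℕ} (h : x (Fin.last n) = M) :
    occupation (M + 1) x = Fin.snoc (occupation M fun j => x (Fin.castSucc j)) 1 := by
  ext k
  induction k using Fin.lastCases with
  | last =>
    have : ∃ j, x j = M := ⟨_, h⟩
    simp [occupation, this]
  | cast k =>
    have : M ≠ k := k.isLt.ne'
    simp [occupation, Fin.exists_fin_succ', h, this]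

/-- The contribution of one ordering `v` of the spectral parameters to the wavefunction, the
particle at position `x j` carrying the parameter `v j`. -/
noncomputable def betheTerm (M : ℕ) (q β : ℂ) {N : ℕ} (v : Fin N → ℂ) (x : Fin N → ℕ) : ℂ :=
  (∏ j, (1 - q) * (-β⁻¹ * v j - (v j)⁻¹) ^ x j * (v j + q * β * (v j)⁻¹) ^ (M - 1 - x j)) *
    ∏ p : Fin N × Fin N with p.1 < p.2, passFactor q (v p.2) (v p.1)

theorem betheTerm_succ_of_lt {M N : ℕ} (q β : ℂ) (v : Fin N → ℂ) {x : Fin N → ℕ}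
    (h : ∀ j, x j < M) :
    betheTerm (M + 1) q β v x = (∏ j, (v j + q * β * (v j)⁻¹)) * betheTerm M q β v x := by
  rw [betheTerm, betheTerm, ← mul_assoc, ← Finset.prod_mul_distrib]
  congr 1
  refine Finset.prod_congr rfl fun j _ => ?_
  have := h j
  rw [show M + 1 - 1 - x j = M - 1 - x j + 1 by omega, pow_succ]
  ring

theorem betheTerm_succ_of_eq {M n : ℕ} (q β : ℂ) (v : Fin (n + 1) → ℂ) {x : Fin (n + 1) → ℕ}
    (h : x (Fin.last n) = M) (h' : ∀ j : Fin n, x j.castSucc < M) :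
    betheTerm (M + 1) q β v x =
      (1 - q) * (-β⁻¹ * v (Fin.last n) - (v (Fin.last n))⁻¹) ^ M *
        (∏ j : Fin n, (v j.castSucc + q * β * (v j.castSucc)⁻¹) *
          passFactor q (v (Fin.last n)) (v j.castSucc)) *
        betheTerm M q β (fun j => v j.castSucc) (fun j => x j.castSucc) := by
  have hs := betheTerm_succ_of_lt q β (fun j => v (Fin.castSucc j)) h'
  rw [Finset.prod_mul_distrib]
  rw [betheTerm] at hs ⊢
  rw [prod_pairs_lt_succ (fun i j => passFactor q (v j) (v i)), Fin.prod_univ_castSucc, h,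
    show M + 1 - 1 - M = 0 by omega, pow_zero, mul_one]
  linear_combination ((1 - q) * (-β⁻¹ * v (Fin.last n) - (v (Fin.last n))⁻¹) ^ M *
    ∏ j : Fin n, passFactor q (v (Fin.last n)) (v j.castSucc)) * hs

/-- The wavefunction as a sum over all orderings of the spectral parameters. -/
theorem finsetState_occupation {ι : Type*} [DecidableEq ι] {q β : ℂ} {u : ι → ℂ}
    (hc : ∀ M i j, Commute (BOperator M q β (u i)) (BOperator M q β (u j)))
    (hβ : β ≠ 0) (hu : ∀ i, u i ≠ 0) (hdist : ∀ i j, i ≠ j → u i ^ 2 ≠ u j ^ 2)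
    (M : ℕ) {N : ℕ} (w : Fin N ↪ ι) (x : Fin N → ℕ) (hx : StrictMono x) (hxM : ∀ j, x j < M) :
    finsetState M hc (Finset.univ.map w) (occupation M x) =
      ∑ σ : Equiv.Perm (Fin N), betheTerm M q β (fun j => u (w (σ j))) x := by
  induction M generalizing N with
  | zero =>
    obtain rfl : N = 0 := by
      by_contra hN
      exact absurd (hxM ⟨0, Nat.pos_of_ne_zero hN⟩) (Nat.not_lt_zero _)
    simp [finsetState_empty, vacuum, betheTerm, Subsingleton.elim (occupation 0 x) fun _ => 0]
  | succ M ih =>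
    by_cases hlt : ∀ j, x j < M
    · have h0 := congrFun (finsetState_snoc_zero hc M (Finset.univ.map w)) (occupation M x)
      rw [occupation_succ_of_lt hlt]
      refine h0.trans ?_
      rw [Pi.smul_apply, smul_eq_mul, ih w x hx hlt, Finset.mul_sum, Finset.prod_map]
      refine Finset.sum_congr rfl fun σ _ => ?_
      rw [betheTerm_succ_of_lt _ _ _ hlt,
        Equiv.prod_comp σ fun j => u (w j) + q * β * (u (w j))⁻¹]
    · obtain ⟨j, hj⟩ := not_forall.1 hlt
      obtain ⟨n, rfl⟩ : ∃ n, N = n + 1 := ⟨N - 1, by have := j.isLt; omega⟩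
      have hlast : x (Fin.last n) = M := by
        have h1 := hx.monotone (Fin.le_last j)
        have h2 := hxM (Fin.last n)
        omega
      have hinit : ∀ j : Fin n, x j.castSucc < M := fun j =>
        hlast ▸ hx (Fin.castSucc_lt_last j)
      have h1 := congrFun (finsetState_snoc_one hc M hβ hu hdist (Finset.univ.map w))
        (occupation M fun j => x (Fin.castSucc j))
      rw [occupation_succ_of_eq hlast]
      refine h1.trans ?_
      rw [Finset.sum_map, sum_perm_succ, Finset.sum_apply]
      refine Finset.sum_congr rfl fun k _ => ?_
      have herase : (Finset.univ.map w).erase (w k) =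
          Finset.univ.map (k.succAboveEmb.trans w) := by
        rw [← Finset.map_erase, ← Finset.map_map]
        congr 1
        ext i
        simp only [Finset.mem_erase, Finset.mem_univ, and_true, Finset.mem_map, true_and]
        exact Fin.exists_succAbove_eq_iff.symm
      rw [herase, Pi.smul_apply, smul_eq_mul,
        ih _ _ (fun i j h => hx (Fin.castSucc_lt_castSucc_iff.2 h)) hinit, Finset.mul_sum,
        Finset.prod_map]
      refine Finset.sum_congr rfl fun τ _ => ?_
      rw [betheTerm_succ_of_eq _ _ _ hlast hinit]
      simp only [permOfLast_last, permOfLast_castSucc]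
      rw [Equiv.prod_comp τ fun j => (u (w (k.succAbove j)) + q * β * (u (w (k.succAbove j)))⁻¹) *
        passFactor q (u (w k)) (u (w (k.succAbove j)))]
      rfl

theorem offShellState_eq_finsetState {ι : Type*} [DecidableEq ι] {q β : ℂ} {u : ι → ℂ}
    (hc : ∀ M i j, Commute (BOperator M q β (u i)) (BOperator M q β (u j)))
    (M : ℕ) {N : ℕ} (w : Fin N ↪ ι) :
    offShellState M q β (fun j => u (w j)) = finsetState M hc (Finset.univ.map w) := by
  induction N with
  | zero => simp [offShellState, finsetState_empty]
  | succ n ih =>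
    have h : (Finset.univ.map w) =
        insert (w 0) (Finset.univ.map ((Fin.succEmb n).trans w)) := by
      rw [Fin.univ_succ, Finset.map_cons, Finset.cons_eq_insert, Finset.map_map]
      rfl
    have h' : w 0 ∉ Finset.univ.map ((Fin.succEmb n).trans w) := by
      simp [Fin.succ_ne_zero]
    rw [h, finsetState_insert hc M h', ← ih, offShellState, offShellState, List.ofFn_succ,
      List.prod_cons, ← Matrix.mulVec_mulVec]
    rfl

theorem single_vecMul_sigmaPlus {M : ℕ} (s : Config M) (j : Fin M) (hj : s j = 0) :
    (Pi.single s 1 : Config M → ℂ) ᵥ* sigmaPlus j = Pi.single (Function.update s j 1) 1 := by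
  ext t
  rw [Matrix.single_one_vecMul, Matrix.row_apply, sigmaPlus, Matrix.of_apply, Pi.single_apply,
    hj]
  have h : t = Function.update s j 1 ↔ t j = 1 ∧ ∀ k, k ≠ j → t k = s k :=
    Function.eq_update_iff
  by_cases h1 : ∀ k, k ≠ j → s k = t k
  · rw [if_pos h1]
    have h2 : t = Function.update s j 1 ↔ t j = 1 := by
      rw [h]
      exact and_iff_left fun k hk => (h1 k hk).symm
    simp only [h2]
    generalize t j = i
    fin_cases i <;> simp
  · rw [if_neg h1, if_neg]
    rw [h]
    exact fun h3 => h1 fun k hk => (h3.2 k hk).symm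

theorem single_vecMul_prod_sigmaPlus {M : ℕ} (l : List (Fin M)) (hl : l.Nodup) (s : Config M)
    (hs : ∀ j ∈ l, s j = 0) :
    (Pi.single s 1 : Config M → ℂ) ᵥ* (l.map sigmaPlus).prod =
      Pi.single (fun k => if k ∈ l then 1 else s k) 1 := by
  induction l generalizing s with
  | nil => simp
  | cons j l ih =>
    rw [List.nodup_cons] at hl
    rw [List.map_cons, List.prod_cons, ← Matrix.vecMul_vecMul,
      single_vecMul_sigmaPlus s j (hs j (by simp)), ih hl.2]
    · congr 1
      ext k
      by_cases hk : k = j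
      · subst hk
        simp
      · simp [hk]
    · intro k hk
      rw [Function.update_of_ne (fun h : k = j => hl.1 (h ▸ hk))]
      exact hs k (by simp [hk])

theorem braConfig_eq_single {M N : ℕ} (x : Fin N → Fin M) (hx : Function.Injective x) :
    braConfig x = Pi.single (occupation M fun j => (x j : ℕ)) 1 := by
  have h := single_vecMul_prod_sigmaPlus (List.ofFn x) (List.nodup_ofFn.2 hx) (fun _ => 0)
    (fun _ _ => rfl)
  rw [List.map_ofFn] at h
  refine h.trans ?_
  congr 1
  ext k
  simp [occupation, List.mem_ofFn, Fin.ext_iff]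

/-- The wavefunction as a sum over permutations. In contrast to the expression with the
normalising prefactor, no weight of the `L`-operator has to be invertible. -/
theorem wavefunction_eq_sum_betheTerm {M N : ℕ} {q β : ℂ} (hβ : β ≠ 0) (u : Fin N → ℂ)
    (hu : ∀ j, u j ≠ 0) (hdist : ∀ j k, j ≠ k → u j ^ 2 ≠ u k ^ 2)
    (hq : ∀ j k, j < k → u k ^ 2 - q * u j ^ 2 ≠ 0 ∨ u j ^ 2 - q * u k ^ 2 ≠ 0)
    (x : Fin N → Fin M) (hx : StrictMono x) :
    wavefunction q β u x =
      ∑ σ : Equiv.Perm (Fin N), betheTerm M q β (fun j => u (σ j)) (fun j => (x j : ℕ)) := by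
  have hc : ∀ M i j, Commute (BOperator M q β (u i)) (BOperator M q β (u j)) := by
    intro M i j
    rcases lt_trichotomy i j with h | rfl | h
    · exact BOperator_commute M q β _ _ hβ (hu i) (hu j) (hq i j h).symm
    · exact Commute.refl _
    · exact BOperator_commute M q β _ _ hβ (hu i) (hu j) (hq j i h)
  rw [wavefunction, braConfig_eq_single x hx.injective, single_one_dotProduct]
  refine (congrFun (offShellState_eq_finsetState hc M (Function.Embedding.refl _)) _).trans ?_
  exact finsetState_occupation hc hβ hu hdist M _ _ (fun i j h => hx h) (fun j => (x j).isLt)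

/-! ### Products over pairs of indices -/

theorem prod_pairs_lt_perm {N : ℕ} (σ : Equiv.Perm (Fin N)) (g : Fin N → Fin N → ℂ)
    (hg : ∀ i j, g i j = g j i) :
    ∏ p : Fin N × Fin N with p.1 < p.2, g (σ p.1) (σ p.2) =
      ∏ p : Fin N × Fin N with p.1 < p.2, g p.1 p.2 := by
  refine Finset.prod_nbij'
    (fun p => (min (σ p.1) (σ p.2), max (σ p.1) (σ p.2)))
    (fun p => (min (σ.symm p.1) (σ.symm p.2), max (σ.symm p.1) (σ.symm p.2))) ?_ ?_ ?_ ?_ ?_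
  · rintro ⟨i, j⟩ h
    simp only [Finset.mem_filter, Finset.mem_univ, true_and] at h ⊢
    exact min_lt_max.2 (σ.injective.ne h.ne)
  · rintro ⟨i, j⟩ h
    simp only [Finset.mem_filter, Finset.mem_univ, true_and] at h ⊢
    exact min_lt_max.2 (σ.symm.injective.ne h.ne)
  · rintro ⟨i, j⟩ h
    simp only [Finset.mem_filter, Finset.mem_univ, true_and] at h
    rcases le_total (σ i) (σ j) with h' | h' <;> simp [h', h.le]
  · rintro ⟨i, j⟩ h
    simp only [Finset.mem_filter, Finset.mem_univ, true_and] at h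
    rcases le_total (σ.symm i) (σ.symm j) with h' | h' <;> simp [h', h.le]
  · rintro ⟨i, j⟩ h
    rcases le_total (σ i) (σ j) with h' | h' <;> simp [h', hg (σ i) (σ j)]

theorem prod_pairs_lt_eq_prod_Ioi {N : ℕ} (g : Fin N → Fin N → ℂ) :
    ∏ p : Fin N × Fin N with p.1 < p.2, g p.1 p.2 = ∏ i, ∏ j ∈ Finset.Ioi i, g i j := by
  rw [Finset.prod_filter, Fintype.prod_prod_type]
  refine Finset.prod_congr rfl fun i _ => ?_
  rw [← Finset.prod_filter]
  refine Finset.prod_congr ?_ fun _ _ => rfl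
  ext j
  simp

theorem prod_pairs_lt_snd {N : ℕ} (g : Fin N → ℂ) :
    ∏ p : Fin N × Fin N with p.1 < p.2, g p.2 = ∏ j, g j ^ (j : ℕ) := by
  rw [Finset.prod_filter, Fintype.prod_prod_type_right]
  refine Finset.prod_congr rfl fun j _ => ?_
  rw [← Finset.prod_filter]
  simp only [Finset.prod_const]
  congr 1
  rw [← Fin.card_Iio j]
  congr 1
  ext i
  simp

theorem prod_pairs_lt_const (N : ℕ) (c : ℂ) :
    ∏ p : Fin N × Fin N with p.1 < p.2, c = c ^ (N * (N - 1) / 2) := by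
  rw [prod_pairs_lt_snd fun _ => c, Finset.prod_pow_eq_pow_sum, Fin.sum_univ_eq_sum_range
    (fun i => i), Finset.sum_range_id]

theorem prod_pairs_lt_rev {N : ℕ} (g : Fin N → Fin N → ℂ) :
    ∏ p : Fin N × Fin N with p.1 < p.2, g p.2.rev p.1.rev =
      ∏ p : Fin N × Fin N with p.1 < p.2, g p.1 p.2 := by
  refine Finset.prod_nbij' (fun p => (p.2.rev, p.1.rev)) (fun p => (p.2.rev, p.1.rev))
    ?_ ?_ ?_ ?_ ?_ <;> simp

/-! ### The two forms of the wavefunction -/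

/-- The factor of a pair of parameters depends on `σ` only through the order in which `σ` lists the
pair. Relative to the identity permutation, only the inversions of `σ` contribute. -/
theorem prod_passFactor_perm {N : ℕ} (q : ℂ) (u : Fin N → ℂ) (hu : ∀ j, u j ≠ 0)
    (hdist : ∀ j k, j ≠ k → u j ^ 2 ≠ u k ^ 2)
    (hq : ∀ j k, j < k → q - (u k) ^ 2 * ((u j)⁻¹) ^ 2 ≠ 0) (σ : Equiv.Perm (Fin N)) :
    ∏ p : Fin N × Fin N with p.1 < p.2, passFactor q (u (σ p.2)) (u (σ p.1)) =
      (∏ p : Fin N × Fin N with p.1 < p.2,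
          (q - ((u p.1)⁻¹) ^ 2 * (u p.2) ^ 2) / (1 - ((u p.1)⁻¹) ^ 2 * (u p.2) ^ 2)) *
        ∏ p : Fin N × Fin N with p.1 < p.2 ∧ σ p.2 < σ p.1,
            (1 - q * (u (σ p.1)) ^ 2 * ((u (σ p.2))⁻¹) ^ 2) /
              (q - (u (σ p.1)) ^ 2 * ((u (σ p.2))⁻¹) ^ 2) := by
  have hpass : ∀ i j, i ≠ j →
      (q - ((u i)⁻¹) ^ 2 * (u j) ^ 2) / (1 - ((u i)⁻¹) ^ 2 * (u j) ^ 2) =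
        passFactor q (u j) (u i) := by
    intro i j hij
    have h1 := sub_ne_zero.2 (hdist i j hij)
    have h2 := sub_ne_zero.2 (hdist j i hij.symm)
    have hi := hu i
    rw [passFactor]
    have h3 : 1 - ((u i)⁻¹) ^ 2 * (u j) ^ 2 = (u i ^ 2 - u j ^ 2) / u i ^ 2 := by
      field_simp
    rw [h3]
    field_simp
    ring
  -- the factor of a pair, independently of the order in which the pair is given
  have hsymm := prod_pairs_lt_perm σ
    (fun i j => if i < j then passFactor q (u j) (u i) else passFactor q (u i) (u j)) (by
      intro i j
      rcases lt_trichotomy i j with h | rfl | h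
      · simp [h, h.not_gt]
      · rfl
      · simp [h, h.not_gt])
  have hid : ∏ p : Fin N × Fin N with p.1 < p.2,
        (q - ((u p.1)⁻¹) ^ 2 * (u p.2) ^ 2) / (1 - ((u p.1)⁻¹) ^ 2 * (u p.2) ^ 2) =
      ∏ p : Fin N × Fin N with p.1 < p.2,
        if p.1 < p.2 then passFactor q (u p.2) (u p.1) else passFactor q (u p.1) (u p.2) := by
    refine Finset.prod_congr rfl fun p hp => ?_
    have hp : p.1 < p.2 := by simpa using hp
    rw [if_pos hp, hpass _ _ hp.ne]
  rw [hid, ← hsymm, ← Finset.filter_filter,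
    Finset.prod_filter (fun p : Fin N × Fin N => σ p.2 < σ p.1),
    ← Finset.prod_mul_distrib]
  refine Finset.prod_congr rfl fun p hp => ?_
  have hp : p.1 < p.2 := by simpa using hp
  rcases lt_or_gt_of_ne (σ.injective.ne hp.ne) with h | h
  · simp [h, h.not_gt]
  · simp only [h, h.not_gt, if_true, if_false]
    have h1 := hq _ _ h
    have h2 := sub_ne_zero.2 (hdist _ _ h.ne)
    have h3 := sub_ne_zero.2 (hdist _ _ h.ne')
    have hi := hu (σ p.2)
    simp only [passFactor]
    have h4 : q - u (σ p.1) ^ 2 * ((u (σ p.2))⁻¹) ^ 2 =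
        -(u (σ p.1) ^ 2 - q * u (σ p.2) ^ 2) / u (σ p.2) ^ 2 := by
      field_simp
      ring
    rw [h4] at h1 ⊢
    have h5 : u (σ p.1) ^ 2 - q * u (σ p.2) ^ 2 ≠ 0 := by
      intro h0
      simp [h0] at h1
    have h6 : 1 - q * u (σ p.1) ^ 2 * ((u (σ p.2))⁻¹) ^ 2 =
        (u (σ p.2) ^ 2 - q * u (σ p.1) ^ 2) / u (σ p.2) ^ 2 := by
      field_simp
    rw [h6, ← neg_sub (u (σ p.2) ^ 2) (u (σ p.1) ^ 2)]
    generalize u (σ p.1) ^ 2 - q * u (σ p.2) ^ 2 = n at *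
    generalize u (σ p.2) ^ 2 - u (σ p.1) ^ 2 = d at *
    field_simp

theorem betheTerm_perm {M N : ℕ} (q β : ℂ) (u : Fin N → ℂ) (hu : ∀ j, u j ≠ 0)
    (hdist : ∀ j k, j ≠ k → u j ^ 2 ≠ u k ^ 2) (x : Fin N → Fin M)
    (ha : ∀ j, u j + q * β * (u j)⁻¹ ≠ 0) (hb : ∀ j, -β⁻¹ * u j - (u j)⁻¹ ≠ 0)
    (hq : ∀ j k, j < k → q - (u k) ^ 2 * ((u j)⁻¹) ^ 2 ≠ 0) (σ : Equiv.Perm (Fin N)) :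
    betheTerm M q β (fun j => u (σ j)) (fun j => (x j : ℕ)) =
      (∏ j, (1 - q) * (u j + q * β * (u j)⁻¹) ^ M / (-β⁻¹ * u j - (u j)⁻¹)) *
        (∏ p : Fin N × Fin N with p.1 < p.2,
          (q - ((u p.1)⁻¹) ^ 2 * (u p.2) ^ 2) / (1 - ((u p.1)⁻¹) ^ 2 * (u p.2) ^ 2)) *
        ((∏ p : Fin N × Fin N with p.1 < p.2 ∧ σ p.2 < σ p.1,
            (1 - q * (u (σ p.1)) ^ 2 * ((u (σ p.2))⁻¹) ^ 2) /
              (q - (u (σ p.1)) ^ 2 * ((u (σ p.2))⁻¹) ^ 2)) *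
          ∏ j, ((-β⁻¹ * u (σ j) - (u (σ j))⁻¹) /
              (u (σ j) + q * β * (u (σ j))⁻¹)) ^ ((x j : ℕ) + 1)) := by
  rw [betheTerm, prod_passFactor_perm q u hu hdist hq σ]
  have h : ∏ j, (1 - q) * (-β⁻¹ * u (σ j) - (u (σ j))⁻¹) ^ (x j : ℕ) *
        (u (σ j) + q * β * (u (σ j))⁻¹) ^ (M - 1 - (x j : ℕ)) =
      (∏ j, (1 - q) * (u j + q * β * (u j)⁻¹) ^ M / (-β⁻¹ * u j - (u j)⁻¹)) *
        ∏ j, ((-β⁻¹ * u (σ j) - (u (σ j))⁻¹) /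
          (u (σ j) + q * β * (u (σ j))⁻¹)) ^ ((x j : ℕ) + 1) := by
    rw [← Equiv.prod_comp σ fun j =>
      (1 - q) * (u j + q * β * (u j)⁻¹) ^ M / (-β⁻¹ * u j - (u j)⁻¹), ← Finset.prod_mul_distrib]
    refine Finset.prod_congr rfl fun j _ => ?_
    have hj := (x j).isLt
    have haj := ha (σ j)
    have hbj := hb (σ j)
    generalize u (σ j) + q * β * (u (σ j))⁻¹ = a at *
    generalize -β⁻¹ * u (σ j) - (u (σ j))⁻¹ = b at *
    have hM : a ^ M = a ^ (M - 1 - (x j : ℕ)) * a ^ ((x j : ℕ) + 1) := by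
      rw [← pow_add]
      congr 1
      omega
    rw [hM, div_pow, pow_succ b]
    field_simp
  rw [h]
  ring

/-- At `q = 0` the orderings of the spectral parameters give the terms of the determinant
defining the Grothendieck polynomial; the order of its columns is opposite to that of the
particles. -/
theorem betheTerm_zero_perm {M N : ℕ} (β : ℂ) (hβ : β ≠ 0) (u : Fin N → ℂ) (hu : ∀ j, u j ≠ 0)
    (hdist : ∀ j k, j ≠ k → u j ^ 2 ≠ u k ^ 2) (x : Fin N → Fin M) (hx : StrictMono x)
    (z : Fin N → ℂ) (hz : ∀ j, z j = -β⁻¹ - ((u j)⁻¹) ^ 2) (σ : Equiv.Perm (Fin N)) :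
    betheTerm M 0 β (fun j => u (σ j.rev)) (fun j => (x j : ℕ)) =
      ((-β) ^ (N * (N - 1) / 2))⁻¹ * (∏ j, u j ^ (M - 1)) *
        ((σ.sign : ℤ) * (∏ k : Fin N, z (σ k) ^ (youngDiagram x k + (N - 1 - (k : ℕ))) *
            (1 + β * z (σ k)) ^ (k : ℕ)) /
          ∏ p : Fin N × Fin N with p.1 < p.2, (z p.1 - z p.2)) := by
  have hsites : ∏ j : Fin N, (1 - 0) * (-β⁻¹ * u (σ j.rev) - (u (σ j.rev))⁻¹) ^ (x j : ℕ) *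
        (u (σ j.rev) + 0 * β * (u (σ j.rev))⁻¹) ^ (M - 1 - (x j : ℕ)) =
      (∏ j, u j ^ (M - 1)) *
        ∏ k : Fin N, z (σ k) ^ (youngDiagram x k + (N - 1 - (k : ℕ))) := by
    rw [← Equiv.prod_comp σ fun j => u j ^ (M - 1), ← Finset.prod_mul_distrib,
      ← Equiv.prod_comp Fin.revPerm]
    refine Finset.prod_congr rfl fun k _ => ?_
    have hk := k.isLt
    have hl := youngDiagram_add x hx k
    have hxk := (x k.rev).isLt
    rw [Fin.revPerm_apply, Fin.rev_rev,
      show youngDiagram x k + (N - 1 - (k : ℕ)) = (x k.rev : ℕ) by omega]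
    have hu' := hu (σ k)
    have hb : -β⁻¹ * u (σ k) - (u (σ k))⁻¹ = u (σ k) * z (σ k) := by
      rw [hz]
      field_simp
    have hM : M - 1 = (x k.rev : ℕ) + (M - 1 - (x k.rev : ℕ)) := by omega
    nth_rewrite 2 [hM]
    rw [hb, pow_add]
    ring
  have hpairs : ∏ p : Fin N × Fin N with p.1 < p.2,
        passFactor 0 (u (σ p.2.rev)) (u (σ p.1.rev)) =
      ((-β) ^ (N * (N - 1) / 2))⁻¹ * (∏ k : Fin N, (1 + β * z (σ k)) ^ (k : ℕ)) *
        ((σ.sign : ℤ) / ∏ p : Fin N × Fin N with p.1 < p.2, (z p.1 - z p.2)) := by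
    have hfactor : ∀ p ∈ Finset.univ.filter (fun p : Fin N × Fin N => p.1 < p.2),
        passFactor 0 (u (σ p.1)) (u (σ p.2)) =
          (-β)⁻¹ * (1 + β * z (σ p.2)) / (z (σ p.1) - z (σ p.2)) := by
      intro p hp
      have hp : p.1 < p.2 := by simpa using hp
      have h1 := sub_ne_zero.2 (hdist _ _ (σ.injective.ne hp.ne))
      have h2 := sub_ne_zero.2 (hdist _ _ (σ.injective.ne hp.ne'))
      have hi := hu (σ p.1)
      have hj := hu (σ p.2)
      have h3 : z (σ p.1) - z (σ p.2) =
          (u (σ p.1) ^ 2 - u (σ p.2) ^ 2) / (u (σ p.1) ^ 2 * u (σ p.2) ^ 2) := by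
        rw [hz, hz]
        field_simp
        ring
      have h4 : 1 + β * z (σ p.2) = -β / u (σ p.2) ^ 2 := by
        rw [hz]
        field_simp
        ring
      rw [passFactor, h3, h4]
      field_simp
      ring
    have hsign := σ.prod_Ioi_comp_eq_sign_mul_prod (f := fun i j => z i - z j)
      (fun i j => (neg_sub _ _).symm)
    rw [← prod_pairs_lt_eq_prod_Ioi fun i j => z (σ i) - z (σ j),
      ← prod_pairs_lt_eq_prod_Ioi fun i j => z i - z j] at hsign
    rw [prod_pairs_lt_rev fun i j => passFactor 0 (u (σ i)) (u (σ j)),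
      Finset.prod_congr rfl hfactor, Finset.prod_div_distrib, Finset.prod_mul_distrib,
      prod_pairs_lt_const, prod_pairs_lt_snd fun k => 1 + β * z (σ k), hsign, inv_pow]
    rcases Int.units_eq_one_or σ.sign with h | h <;> simp [h] <;> ring
  rw [betheTerm, hsites, hpairs, Finset.prod_mul_distrib]
  ring

/-- The wavefunction of the `β`-deformed `U_q(sl_2)` `L`-operator as a sum over `S_N`, and its
value at `q = 0` as a `β`-Grothendieck polynomial. The position of the `j`-th particle is
`(x j : ℕ) + 1`. -/
theorem mainTheorem1 (M N : ℕ) (β : ℂ) (hβ : β ≠ 0)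
    (u : Fin N → ℂ) (hu : ∀ j, u j ≠ 0) (hdist : ∀ j k, j ≠ k → u j ^ 2 ≠ u k ^ 2)
    (x : Fin N → Fin M) (hx : StrictMono x) :
    (∀ q : ℂ,
      (∀ j, u j + q * β * (u j)⁻¹ ≠ 0) →
      (∀ j, -β⁻¹ * u j - (u j)⁻¹ ≠ 0) →
      (∀ j k, j < k → q - (u k) ^ 2 * ((u j)⁻¹) ^ 2 ≠ 0) →
      wavefunction q β u x =
        (∏ j, (1 - q) * (u j + q * β * (u j)⁻¹) ^ M / (-β⁻¹ * u j - (u j)⁻¹)) *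
        (∏ p : Fin N × Fin N with p.1 < p.2,
          (q - ((u p.1)⁻¹) ^ 2 * (u p.2) ^ 2) / (1 - ((u p.1)⁻¹) ^ 2 * (u p.2) ^ 2)) *
        ∑ σ : Equiv.Perm (Fin N),
          (∏ p : Fin N × Fin N with p.1 < p.2 ∧ σ p.2 < σ p.1,
            (1 - q * (u (σ p.1)) ^ 2 * ((u (σ p.2))⁻¹) ^ 2) /
              (q - (u (σ p.1)) ^ 2 * ((u (σ p.2))⁻¹) ^ 2)) *
          ∏ j, ((-β⁻¹ * u (σ j) - (u (σ j))⁻¹) /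
              (u (σ j) + q * β * (u (σ j))⁻¹)) ^ ((x j : ℕ) + 1)) ∧
    wavefunction 0 β u x =
      ((-β) ^ (N * (N - 1) / 2))⁻¹ * (∏ j, u j ^ (M - 1)) *
        grothendieck (youngDiagram x) (fun j => -β⁻¹ - ((u j)⁻¹) ^ 2) β := by
  constructor
  · intro q ha hb hq
    rw [wavefunction_eq_sum_betheTerm hβ u hu hdist _ x hx, Finset.mul_sum]
    · exact Finset.sum_congr rfl fun σ _ => betheTerm_perm q β u hu hdist x ha hb hq σ
    · intro j k hjk
      left
      intro h
      apply hq j k hjk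
      have hj := hu j
      field_simp
      linear_combination -h
  · rw [wavefunction_eq_sum_betheTerm hβ u hu hdist _ x hx]
    · rw [grothendieck, Matrix.det_apply', Finset.sum_div, Finset.mul_sum,
        -- the columns of the determinant list the particles from right to left
        ← Equiv.sum_comp (Equiv.mulRight (Fin.revPerm : Equiv.Perm (Fin N)))]
      refine Finset.sum_congr rfl fun σ _ => ?_
      exact betheTerm_zero_perm β hβ u hu hdist x hx _ (fun _ => rfl) σ
    · intro j k _
      left
      simpa using hu k
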